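/- Let $R_0$ be the monoid algebra over $\mathbb{F}_2$ of the monoid of all formal monomials $X^aY^bZ^c\prod_{i\ge 1}T_i^{t_i}$ with $a,b,c,t_i\in\mathbb{Q}_{\ge 0}$ (infinitely many $t_i$ may be nonzero), multiplied by adding exponents. Let $J=\{\prod_{i\ge 1}T_i^{t_i} : t_i\in\mathbb{Q}_{\ge 0}\}$, and let $$R=\mathbb{F}_2\big[\{X^\alpha,Y^\alpha,Z^\alpha : \alpha\in\mathbb{Q}_{\ge 0}\}\cup\{X^\alpha T,Y^\alpha T,Z^\alpha T : \alpha\in\mathbb{Q}_{>0},\ T\in J\}\big]\subseteq R_0 .$$ A polynomial over an integral domain $D$ is *primitive* if the ideal generated by its coefficients is not contained in any proper principal ideal of $D$, and $D$ is a *GL-domain* if the product of any two primitive polynomials over $D$ is primitive. A common divisor $d$ of a set $S$ is a *maximal common divisor* (MCD) of $S$ if every common divisor $d'$ of $S$ with $d\mid d'$ is an associate of $d$; $D$ is *MCD-finite* if every nonempty finite set of nonzero elements of $D$ has only finitely many MCDs up to associates. **Proposition.** The ring $R$ is an integral domain and a GL-domain, and it is not MCD-finite. Specifically, the elements $s_y=XY\prod_{i\ge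 1}T_i$ and $s_z=XZ\prod_{i\ge 1}T_i$ of $R$ have infinitely many pairwise non-associate maximal common divisors in $R$. -/

import Mathlib

namespace GLExample

/-- An integral domain `D` is a GL-domain if the product of two primitive polynomials over `D` is
primitive. Here `f.IsPrimitive` says that every `r : D` with `C r ∣ f` is a unit, i.e. the ideal
generated by the coefficients of `f` is not contained in any proper principal ideal. -/
def IsGLDomain (D : Type*) [CommRing D] : Prop :=
  IsDomain D ∧ ∀ f g : Polynomial D, f.IsPrimitive → g.IsPrimitive → (f * g).IsPrimitive

/-- `d` is a maximal common divisor of `S`. -/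
def IsMCD {M : Type*} [CommMonoid M] (S : Set M) (d : M) : Prop :=
  (∀ s ∈ S, d ∣ s) ∧ ∀ d' : M, (∀ s ∈ S, d' ∣ s) → d ∣ d' → Associated d d'

/-- The set of associate classes of maximal common divisors of `S`. -/
def mcdClasses {M : Type*} [CommMonoid M] (S : Set M) : Set (Associates M) :=
  {c | ∃ d : M, IsMCD S d ∧ Associates.mk d = c}

/-- A domain `D` is MCD-finite if every nonempty finite set of nonzero elements has only finitely
many maximal common divisors up to associates. -/
def IsMCDFinite (D : Type*) [CommRing D] : Prop :=
  ∀ S : Set D, S.Finite → S.Nonempty → (0 : D) ∉ S → (mcdClasses S).Finite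

/-- The indeterminates `X, Y, Z, T₁, T₂, T₃, …`. -/
inductive Var : Type
  | X : Var
  | Y : Var
  | Z : Var
  | T (i : ℕ+) : Var

/-- The exponent vector of `X ^ a * Y ^ b * Z ^ c * ∏ i, T i ^ t i`. -/
def expo (a b c : ℚ≥0) (t : ℕ+ → ℚ≥0) : Var → ℚ≥0
  | Var.X => a
  | Var.Y => b
  | Var.Z => c
  | Var.T i => t i

/-- The monoid algebra over `𝔽₂` of all (possibly infinite) formal products of powers of the
indeterminates with nonnegative rational exponents. -/
abbrev R₀ : Type := AddMonoidAlgebra (ZMod 2) (Var → ℚ≥0)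

/-- The monomial `X ^ a * Y ^ b * Z ^ c * ∏ i, T i ^ t i` of `R₀`. -/
noncomputable def mono (a b c : ℚ≥0) (t : ℕ+ → ℚ≥0) : R₀ :=
  AddMonoidAlgebra.single (expo a b c t) 1

theorem mono_mul (a b c a' b' c' : ℚ≥0) (t t' : ℕ+ → ℚ≥0) :
    mono a b c t * mono a' b' c' t' = mono (a + a') (b + b') (c + c') (t + t') := by
  have h : expo a b c t + expo a' b' c' t' = expo (a + a') (b + b') (c + c') (t + t') := by
    funext v
    cases v <;> rfl
  simp [mono, AddMonoidAlgebra.single_mul_single, h]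

/-- The generators `X ^ α, Y ^ α, Z ^ α` with `α ≥ 0`. -/
def pureGenerators : Set R₀ :=
  {f | ∃ α : ℚ≥0, f = mono α 0 0 0 ∨ f = mono 0 α 0 0 ∨ f = mono 0 0 α 0}

/-- The generators `X ^ α * T, Y ^ α * T, Z ^ α * T` with `α > 0` and `T = ∏ i, T i ^ t i`. -/
def mixedGenerators : Set R₀ :=
  {f | ∃ (α : ℚ≥0) (t : ℕ+ → ℚ≥0), 0 < α ∧
    (f = mono α 0 0 t ∨ f = mono 0 α 0 t ∨ f = mono 0 0 α t)}

/-- The subring `R` of `R₀` generated over `𝔽₂` by these monomials. -/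
noncomputable def R : Subalgebra (ZMod 2) R₀ :=
  Algebra.adjoin (ZMod 2) (pureGenerators ∪ mixedGenerators)

theorem sY_mem : mono 1 1 0 1 ∈ R := by
  have h : mono 1 1 0 1 = mono 1 0 0 0 * mono 0 1 0 1 := by simp [mono_mul]
  rw [h]
  exact mul_mem (Algebra.subset_adjoin (Or.inl ⟨1, Or.inl rfl⟩))
    (Algebra.subset_adjoin (Or.inr ⟨1, 1, one_pos, Or.inr (Or.inl rfl)⟩))

theorem sZ_mem : mono 1 0 1 1 ∈ R := by
  have h : mono 1 0 1 1 = mono 1 0 0 0 * mono 0 0 1 1 := by simp [mono_mul]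
  rw [h]
  exact mul_mem (Algebra.subset_adjoin (Or.inl ⟨1, Or.inl rfl⟩))
    (Algebra.subset_adjoin (Or.inr ⟨1, 1, one_pos, Or.inr (Or.inr rfl)⟩))

/-- The element `X * Y * ∏ i, T i` of `R`. -/
noncomputable def sY : R := ⟨mono 1 1 0 1, sY_mem⟩

/-- The element `X * Z * ∏ i, T i` of `R`. -/
noncomputable def sZ : R := ⟨mono 1 0 1 1, sZ_mem⟩

end GLExample

/-! An element of `R₀` lies in `R` exactly when its part of degree zero in `X, Y, Z` is 0 or 1
(`mem_R_iff`). GL: suppose `r` in `R` divides `f * g` with `f`, `g` primitive. Polynomials over `R₀`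
form a decomposition monoid (`decompositionMonoid_polynomial`), so `r = a * b` in `R₀` with `a ∣ f`,
`b ∣ g`. If `a` had degree-zero part 0, then its square root, which exists over `𝔽₂`, would be a
nonunit of `R` dividing `f` over `R`. So both degree-zero parts are nonzero; their product is 1 and
`R₀` has no unit but 1, so both are 1. Then `a`, `b` lie in `R`, divide there, and equal 1. MCDs:
each `xT q` with `q ≤ 1` leaves cofactors `Y * ∏ T i ^ p` and `Z * ∏ T i ^ p`, where `p = 1 - q`.
Their common divisors in `R₀` are monomials in the `T i` alone, and only 1 of these lies in `R`. -/

namespace AddMonoidAlgebra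

/-! ### Supports and least exponents -/

section Support

variable {K G : Type*} [Field K]

theorem mem_range_mapDomainRingHom {S : Type*} [AddMonoid S] [AddMonoid G] {j : S →+ G}
    (hj : Function.Injective j) {F : AddMonoidAlgebra K G}
    (hF : ∀ s ∈ F.coeff.support, s ∈ Set.range j) : ∃ f, mapDomainRingHom K j f = F :=
  ⟨comapDomain j hj F, mapDomain_comapDomain (fun s hs => hF s hs) hj⟩

theorem mapDomainRingHom_injective {S : Type*} [AddMonoid S] [AddMonoid G] {j : S →+ G}
    (hj : Function.Injective j) : Function.Injective (mapDomainRingHom K j) :=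
  mapDomain_injective hj

theorem coeff_support_nonempty {F : AddMonoidAlgebra K G} (hF : F ≠ 0) :
    F.coeff.support.Nonempty := by
  rw [Finsupp.support_nonempty_iff]
  exact fun h => hF (coeff_eq_zero.1 h)

/-- The least value of an additive functional on the exponents is additive in the factors. -/
theorem isLeast_image_support_mul [AddMonoid G] [UniqueSums G] {F F' : AddMonoidAlgebra K G}
    (v : G →+ ℚ) {a b : ℚ} (ha : IsLeast (v '' F.coeff.support) a)
    (hb : IsLeast (v '' F'.coeff.support) b) :
    IsLeast (v '' (F * F').coeff.support) (a + b) := by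
  classical
  constructor
  · obtain ⟨⟨s, hs, rfl⟩, hla⟩ := ha
    obtain ⟨⟨t, ht, rfl⟩, hlb⟩ := hb
    -- A sum unique among the exponents minimizing `v` is unique overall: two exponents whose sum
    -- has the least value are both minimizers.
    obtain ⟨p, hp, q, hq, hu⟩ := UniqueSums.uniqueAdd_of_nonempty
      (A := F.coeff.support.filter (fun x => v x = v s))
      (B := F'.coeff.support.filter (fun x => v x = v t))
      ⟨s, Finset.mem_filter.2 ⟨hs, rfl⟩⟩ ⟨t, Finset.mem_filter.2 ⟨ht, rfl⟩⟩
    rw [Finset.mem_filter] at hp hq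
    have hU : UniqueAdd F.coeff.support F'.coeff.support p q := by
      intro x y hx hy hxy
      have h1 := hla ⟨x, hx, rfl⟩
      have h2 := hlb ⟨y, hy, rfl⟩
      have h3 : v x + v y = v s + v t := by
        rw [← map_add, hxy, map_add, hp.2, hq.2]
      exact hu (Finset.mem_filter.2 ⟨hx, by linarith⟩) (Finset.mem_filter.2 ⟨hy, by linarith⟩) hxy
    refine ⟨p + q, ?_, by rw [map_add, hp.2, hq.2]⟩
    rw [Finset.mem_coe, Finsupp.mem_support_iff, coeff_mul_add_of_uniqueAdd hU]
    exact mul_ne_zero (Finsupp.mem_support_iff.1 hp.1) (Finsupp.mem_support_iff.1 hq.1)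
  · rintro _ ⟨s, hs, rfl⟩
    obtain ⟨x, hx, y, hy, rfl⟩ := Finset.mem_add.1 (support_coeff_mul_subset _ _ hs)
    rw [map_add]
    exact add_le_add (ha.2 ⟨x, hx, rfl⟩) (hb.2 ⟨y, hy, rfl⟩)

theorem exists_isLeast_image_support {ι : Type*} [AddMonoid G] (v : ι → G →+ ℚ)
    (hinf : ∀ g h, ∃ m, ∀ i, v i m = min (v i g) (v i h)) {F : AddMonoidAlgebra K G}
    (hF : F ≠ 0) : ∃ u, ∀ i, IsLeast (v i '' F.coeff.support) (v i u) := by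
  classical
  suffices H : ∀ A : Finset G, A.Nonempty → ∃ u, ∀ i, IsLeast (v i '' A) (v i u) from
    H _ (coeff_support_nonempty hF)
  intro A hA
  induction hA using Finset.Nonempty.cons_induction with
  | singleton a => exact ⟨a, fun i => by simp⟩
  | cons a A ha hA ih =>
    obtain ⟨u, hu⟩ := ih
    obtain ⟨m, hm⟩ := hinf a u
    refine ⟨m, fun i => ?_⟩
    rw [hm, Finset.coe_cons, Set.image_insert_eq]
    exact (hu i).insert _

end Support

/-! ### Decomposition in group algebras and positive cones -/

section Group

variable {K G : Type*} [Field K] [AddCommGroup G] [IsAddTorsionFree G]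

/-- After a translation, a finite subset of a torsion-free group lies in a free commutative
submonoid of finite rank. -/
theorem exists_free_submonoid_translate (A : Finset G) :
    ∃ (n : ℕ) (φ : (Fin n →₀ ℕ) →+ G) (m : G), Function.Injective φ ∧
      ∀ x ∈ A, m + x ∈ Set.range φ := by
  classical
  let H := Submodule.span ℤ (A : Set G)
  have : Module.Finite ℤ H := Module.Finite.span_finset ℤ A
  let b := Module.finBasis ℤ H
  let n := Module.finrank ℤ H
  let φ : (Fin n →₀ ℕ) →+ G :=
    (H.subtype.toAddMonoidHom.comp b.repr.symm.toLinearMap.toAddMonoidHom).comp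
      (Finsupp.mapRange.addMonoidHom (Nat.castAddMonoidHom ℤ))
  let r : G → Fin n →₀ ℤ := fun x => if hx : x ∈ H then b.repr ⟨x, hx⟩ else 0
  -- This shift dominates every coordinate of every point of `A`, so it makes them all nonnegative.
  let N : Fin n →₀ ℤ := Finsupp.equivFunOnFinite.symm (fun k => ∑ x ∈ A, |r x k|)
  refine ⟨n, φ, b.repr.symm N, ?_, ?_⟩
  · intro x y hxy
    have h1 : b.repr.symm (Finsupp.mapRange.addMonoidHom (Nat.castAddMonoidHom ℤ) x) =
      b.repr.symm (Finsupp.mapRange.addMonoidHom (Nat.castAddMonoidHom ℤ) y) := Subtype.ext hxy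
    have h2 := b.repr.symm.injective h1
    ext k
    simpa using DFunLike.congr_fun h2 k
  · intro x hx
    have hxH : x ∈ H := Submodule.subset_span hx
    refine ⟨Finsupp.equivFunOnFinite.symm (fun k => (N k + r x k).toNat), ?_⟩
    have h1 : Finsupp.mapRange.addMonoidHom (Nat.castAddMonoidHom ℤ)
        (Finsupp.equivFunOnFinite.symm (fun k => (N k + r x k).toNat)) = N + r x := by
      ext k
      have h2 : |r x k| ≤ N k :=
        Finset.single_le_sum (f := fun x => |r x k|) (fun _ _ => abs_nonneg _) hx
      have h3 := neg_abs_le (r x k)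
      simp only [Finsupp.mapRange.addMonoidHom_apply, Finsupp.mapRange_apply,
        Finsupp.equivFunOnFinite_symm_apply_apply, Finsupp.add_apply, Nat.coe_castAddMonoidHom]
      omega
    change ((b.repr.symm (Finsupp.mapRange.addMonoidHom (Nat.castAddMonoidHom ℤ)
        (Finsupp.equivFunOnFinite.symm (fun k => (N k + r x k).toNat))) : H) : G) = _
    rw [h1, map_add]
    simp [r, hxH]

/-- Monomials are units, so a single equation can be translated into a polynomial ring in finitely
many variables, which is a UFD. -/
theorem decompositionMonoid_of_group : DecompositionMonoid (AddMonoidAlgebra K G) := by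
  classical
  refine ⟨fun d f g ⟨e, he⟩ => ?_⟩
  obtain ⟨n, φ, m, hφ, hm⟩ := exists_free_submonoid_translate
    (d.coeff.support ∪ e.coeff.support ∪ f.coeff.support ∪ g.coeff.support)
  let X : AddMonoidAlgebra K G := single m 1
  let Y : AddMonoidAlgebra K G := single (-m) 1
  have hXY : X * Y = 1 := by simp [X, Y, single_mul_single, one_def]
  have key : ∀ q : AddMonoidAlgebra K G, (∀ x ∈ q.coeff.support, m + x ∈ Set.range φ) →
      ∃ p : MvPolynomial (Fin n) K, mapDomainRingHom K φ p = X * q := by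
    intro q hq
    refine mem_range_mapDomainRingHom hφ fun s hs => ?_
    obtain ⟨x, hx, rfl⟩ := Finset.mem_image.1 (support_coeff_single_mul_subset _ _ _ hs)
    exact hq x hx
  obtain ⟨d', hd⟩ := key d fun x hx => hm x (by simp_all)
  obtain ⟨e', he'⟩ := key e fun x hx => hm x (by simp_all)
  obtain ⟨f', hf⟩ := key f fun x hx => hm x (by simp_all)
  obtain ⟨g', hg⟩ := key g fun x hx => hm x (by simp_all)
  have hdvd : d' ∣ f' * g' := by
    refine ⟨e', mapDomainRingHom_injective hφ ?_⟩
    refine (map_mul _ f' g').trans (Eq.trans ?_ (map_mul _ d' e').symm)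
    rw [hd, he', hf, hg, mul_mul_mul_comm, he, mul_mul_mul_comm]
  obtain ⟨a, b, ⟨a', ha⟩, ⟨b', hb⟩, hab⟩ := exists_dvd_and_dvd_of_dvd_mul hdvd
  have hf2 : X * f = mapDomainRingHom K φ a * mapDomainRingHom K φ a' := by
    rw [← hf, ha]; exact map_mul _ _ _
  have hg2 : X * g = mapDomainRingHom K φ b * mapDomainRingHom K φ b' := by
    rw [← hg, hb]; exact map_mul _ _ _
  have hd2 : X * d = mapDomainRingHom K φ a * mapDomainRingHom K φ b := by
    rw [← hd, hab]; exact map_mul _ _ _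
  refine ⟨Y * mapDomainRingHom K φ a, mapDomainRingHom K φ b,
    ⟨mapDomainRingHom K φ a', ?_⟩, ⟨Y * mapDomainRingHom K φ b', ?_⟩, ?_⟩
  · linear_combination Y * hf2 - f * hXY
  · linear_combination Y * hg2 - g * hXY
  · linear_combination Y * hd2 - d * hXY

/-- The monoid algebra of the positive cone of a torsion-free group, ordered by a family of
functionals for which any two elements have an infimum, is a decomposition monoid. -/
theorem decompositionMonoid_of_positive_cone [UniqueSums G] {ι S : Type*} [AddCommMonoid S] (j : S →+ G)
    (hj : Function.Injective j) (v : ι → G →+ ℚ)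
    (hrange : ∀ g, g ∈ Set.range j ↔ ∀ i, 0 ≤ v i g)
    (hinf : ∀ g h, ∃ m, ∀ i, v i m = min (v i g) (v i h)) :
    DecompositionMonoid (AddMonoidAlgebra K S) := by
  classical
  have := decompositionMonoid_of_group (K := K) (G := G)
  let J := mapDomainRingHom K j
  have hJ : Function.Injective J := mapDomainRingHom_injective hj
  have hpos : ∀ (f : AddMonoidAlgebra K S) (i : ι) (a : ℚ),
      IsLeast (v i '' (J f).coeff.support) a → 0 ≤ a := by
    rintro f i _ ⟨⟨s, hs, rfl⟩, -⟩
    refine (hrange s).1 ?_ i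
    obtain ⟨x, -, rfl⟩ := Finset.mem_image.1 (Finsupp.mapDomain_support hs)
    exact ⟨x, rfl⟩
  have hlift : ∀ (F : AddMonoidAlgebra K G) (u w : G),
      (∀ i, IsLeast (v i '' F.coeff.support) (v i u)) → (∀ i, 0 ≤ v i w + v i u) →
      ∃ f, J f = single w 1 * F := by
    intro F u w hu hw
    refine mem_range_mapDomainRingHom hj fun s hs => (hrange s).2 fun i => ?_
    obtain ⟨x, hx, rfl⟩ := Finset.mem_image.1 (support_coeff_single_mul_subset _ _ _ hs)
    rw [map_add]
    have := (hu i).2 ⟨x, hx, rfl⟩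
    linarith [hw i]
  refine ⟨fun d f g ⟨e, he⟩ => ?_⟩
  by_cases hfz : f = 0
  · exact ⟨d, 1, by simp [hfz], one_dvd _, by simp⟩
  by_cases hgz : g = 0
  · exact ⟨1, d, one_dvd _, by simp [hgz], by simp⟩
  have hF0 : J f ≠ 0 := (map_ne_zero_iff J hJ).2 hfz
  have hG0 : J g ≠ 0 := (map_ne_zero_iff J hJ).2 hgz
  have hE : J f * J g = J d * J e := by rw [← map_mul, he, map_mul]
  obtain ⟨D₁, D₂, ⟨H₁, hH₁⟩, ⟨H₂, hH₂⟩, hD⟩ := exists_dvd_and_dvd_of_dvd_mul (Dvd.intro _ hE.symm)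
  rw [hH₁] at hF0
  rw [hH₂] at hG0
  have hD0 : D₁ * D₂ ≠ 0 := mul_ne_zero (left_ne_zero_of_mul hF0) (left_ne_zero_of_mul hG0)
  have hEH : J e = H₁ * H₂ := by
    refine mul_left_cancel₀ hD0 ?_
    rw [← hD, ← hE, hH₁, hH₂, hD]; ring
  obtain ⟨u₁, hu₁⟩ := exists_isLeast_image_support v hinf (left_ne_zero_of_mul hF0)
  obtain ⟨u₂, hu₂⟩ := exists_isLeast_image_support v hinf (left_ne_zero_of_mul hG0)
  obtain ⟨h₁, hh₁⟩ := exists_isLeast_image_support v hinf (right_ne_zero_of_mul hF0)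
  obtain ⟨h₂, hh₂⟩ := exists_isLeast_image_support v hinf (right_ne_zero_of_mul hG0)
  have p₁ : ∀ i, 0 ≤ v i u₁ + v i h₁ := fun i =>
    hpos f i _ (hH₁ ▸ isLeast_image_support_mul (v i) (hu₁ i) (hh₁ i))
  have p₂ : ∀ i, 0 ≤ v i u₂ + v i h₂ := fun i =>
    hpos g i _ (hH₂ ▸ isLeast_image_support_mul (v i) (hu₂ i) (hh₂ i))
  have p₃ : ∀ i, 0 ≤ v i u₁ + v i u₂ := fun i =>
    hpos d i _ (hD ▸ isLeast_image_support_mul (v i) (hu₁ i) (hu₂ i))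
  have p₄ : ∀ i, 0 ≤ v i h₁ + v i h₂ := fun i =>
    hpos e i _ (hEH ▸ isLeast_image_support_mul (v i) (hh₁ i) (hh₂ i))
  -- The factors over the group are rebalanced by the monomial of exponent `w`. All four land in the
  -- cone when `-u₁, -h₂ ≤ w ≤ u₂, h₁`; `p₁` to `p₄` say that each lower bound is below each upper
  -- bound, so the infimum of the upper bounds works.
  obtain ⟨w, hw⟩ := hinf u₂ h₁
  have hw₁ : ∀ i, v i w ≤ v i u₂ := fun i => hw i ▸ min_le_left _ _
  have hw₂ : ∀ i, v i w ≤ v i h₁ := fun i => hw i ▸ min_le_right _ _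
  have hw₃ : ∀ i, 0 ≤ v i u₁ + v i w := fun i => by
    rw [hw]; rcases min_choice (v i u₂) (v i h₁) with h | h <;> rw [h] <;> linarith [p₁ i, p₃ i]
  have hw₄ : ∀ i, 0 ≤ v i w + v i h₂ := fun i => by
    rw [hw]; rcases min_choice (v i u₂) (v i h₁) with h | h <;> rw [h] <;> linarith [p₂ i, p₄ i]
  obtain ⟨d₁, hd₁⟩ := hlift D₁ u₁ w hu₁ fun i => by linarith [hw₃ i]
  obtain ⟨d₂, hd₂⟩ := hlift D₂ u₂ (-w) hu₂ fun i => by rw [map_neg]; linarith [hw₁ i]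
  obtain ⟨k₁, hk₁⟩ := hlift H₁ h₁ (-w) hh₁ fun i => by rw [map_neg]; linarith [hw₂ i]
  obtain ⟨k₂, hk₂⟩ := hlift H₂ h₂ w hh₂ fun i => by linarith [hw₄ i]
  have hww : (single w 1 : AddMonoidAlgebra K G) * single (-w) 1 = 1 := by
    simp [single_mul_single, one_def]
  refine ⟨d₁, d₂, ⟨k₁, hJ ?_⟩, ⟨k₂, hJ ?_⟩, hJ ?_⟩
  · rw [map_mul, hd₁, hk₁, hH₁]; linear_combination -(D₁ * H₁) * hww
  · rw [map_mul, hd₂, hk₂, hH₂]; linear_combination -(D₂ * H₂) * hww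
  · rw [map_mul, hd₁, hd₂, hD]; linear_combination -(D₁ * D₂) * hww

end Group

end AddMonoidAlgebra

/-! ### Divisors of monomials and square roots -/

namespace AddMonoidAlgebra

/-- In a monoid algebra with two unique sums, divisors of monomials are monomials. -/
theorem eq_single_of_mul_eq_single {K G : Type*} [Field K] [AddMonoid G] [TwoUniqueSums G]
    {f g : AddMonoidAlgebra K G} {s : G} {r : K} (hr : r ≠ 0) (h : f * g = single s r) :
    ∃ a b c d, f = single a c ∧ g = single b d ∧ a + b = s ∧ c ≠ 0 := by
  classical
  have hfg : f * g ≠ 0 := h ▸ single_ne_zero.2 hr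
  have hf := coeff_support_nonempty (left_ne_zero_of_mul hfg)
  have hg := coeff_support_nonempty (right_ne_zero_of_mul hfg)
  have hmem : ∀ a ∈ f.coeff.support, ∀ b ∈ g.coeff.support,
      UniqueAdd f.coeff.support g.coeff.support a b → a + b = s := by
    intro a ha b hb hu
    by_contra hne
    have h1 := coeff_mul_add_of_uniqueAdd hu
    rw [h, coeff_single, Finsupp.single_eq_of_ne hne] at h1
    exact mul_ne_zero (Finsupp.mem_support_iff.1 ha) (Finsupp.mem_support_iff.1 hb) h1.symm
  -- Otherwise two distinct pairs would have unique sums, yet both sums equal `s`.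
  have hcard : f.coeff.support.card * g.coeff.support.card ≤ 1 := by
    by_contra hlt
    obtain ⟨p, hp, q, hq, hne, hup, huq⟩ :=
      TwoUniqueSums.uniqueAdd_of_one_lt_card (not_le.1 hlt)
    rw [Finset.mem_product] at hp hq
    have := hup hq.1 hq.2
      ((hmem _ hq.1 _ hq.2 huq).trans (hmem _ hp.1 _ hp.2 hup).symm)
    exact hne (Prod.ext this.1.symm this.2.symm)
  have hf1 : f.coeff.support.card = 1 := by
    have := hf.card_pos; have := hg.card_pos; nlinarith
  have hg1 : g.coeff.support.card = 1 := by
    have := hf.card_pos; have := hg.card_pos; nlinarith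
  obtain ⟨a, c, hc, hfa⟩ := Finsupp.card_support_eq_one'.1 hf1
  obtain ⟨b, d, hd, hgb⟩ := Finsupp.card_support_eq_one'.1 hg1
  have hfs : f = single a c := coeff_injective (by simpa using hfa)
  have hgs : g = single b d := coeff_injective (by simpa using hgb)
  refine ⟨a, b, c, d, hfs, hgs, ?_, hc⟩
  rw [hfs, hgs, single_mul_single] at h
  exact ((single_inj.1 h).resolve_right fun h' => hr h'.2).1

/-- Over a field with two elements, every element of the monoid algebra of a uniquely
2-divisible monoid is a square. -/
theorem exists_sq_eq {G : Type*} [AddCommMonoid G] (hG : ∀ s : G, ∃ t, t + t = s)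
    (f : AddMonoidAlgebra (ZMod 2) G) : ∃ e, e ^ 2 = f := by
  have : CharP (AddMonoidAlgebra (ZMod 2) G) 2 :=
    charP_of_injective_algebraMap (algebraMap (ZMod 2) (AddMonoidAlgebra (ZMod 2) G)).injective 2
  induction f using AddMonoidAlgebra.induction_linear with
  | zero => exact ⟨0, by simp⟩
  | add f g hf hg =>
    obtain ⟨a, rfl⟩ := hf
    obtain ⟨b, rfl⟩ := hg
    exact ⟨a + b, CharTwo.add_sq a b⟩
  | single s r =>
    obtain ⟨t, rfl⟩ := hG s
    refine ⟨single t r, ?_⟩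
    rw [sq, single_mul_single]
    congr 1
    revert r; decide

end AddMonoidAlgebra

/-! ### Decomposition over `R₀` and the degree-zero description of `R` -/

namespace GLExample

open Polynomial AddMonoidAlgebra

/-- Exponent vectors of polynomials over `R₀`, embedded in a torsion-free group. -/
def exponentEmbedding : ℕ × (Var → ℚ≥0) →+ ℤ × (Var → ℚ) where
  toFun p := (p.1, fun i => p.2 i)
  map_zero' := by ext <;> simp
  map_add' p q := by ext <;> simp

/-- The coordinates of an exponent vector. -/
def exponentCoord : Option Var → ℤ × (Var → ℚ) →+ ℚ
  | none => (Int.castAddHom ℚ).comp (AddMonoidHom.fst _ _)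
  | some i => (Pi.evalAddMonoidHom (fun _ : Var => ℚ) i).comp (AddMonoidHom.snd _ _)

/-- This is the monoid algebra of a positive cone in `ℤ × (Var → ℚ)`, where infima are
coordinatewise minima. -/
theorem decompositionMonoid_polynomial : DecompositionMonoid R₀[X] := by
  have h : DecompositionMonoid (AddMonoidAlgebra (ZMod 2) (ℕ × (Var → ℚ≥0))) := by
    refine decompositionMonoid_of_positive_cone exponentEmbedding ?_ exponentCoord ?_ ?_
    · intro p q h
      rw [Prod.ext_iff] at h
      refine Prod.ext (Nat.cast_injective (R := ℤ) h.1) (funext fun i => ?_)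
      exact NNRat.cast_injective (α := ℚ) (congrFun h.2 i)
    · intro g
      constructor
      · rintro ⟨p, rfl⟩ (_ | i)
        · exact Int.cast_nonneg (Int.natCast_nonneg p.1)
        · exact NNRat.cast_nonneg (p.2 i)
      · intro hg
        have h0 : 0 ≤ g.1 := Int.cast_nonneg_iff.1 (hg none)
        refine ⟨(g.1.toNat, fun i => ⟨g.2 i, hg (some i)⟩), ?_⟩
        exact Prod.ext (Int.toNat_of_nonneg h0) rfl
    · intro g h
      refine ⟨g ⊓ h, ?_⟩
      rintro (_ | i)
      · exact Int.cast_min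
      · rfl
  exact MulEquiv.decompositionMonoid
    ((toFinsuppIso R₀).trans (curryRingEquiv (R := ZMod 2) (M := ℕ) (N := Var → ℚ≥0)).symm)

/-- An exponent vector of degree zero in `X, Y, Z`. -/
def DegreeZero (s : Var → ℚ≥0) : Prop := s Var.X = 0 ∧ s Var.Y = 0 ∧ s Var.Z = 0

/-- This face property is what makes `degreeZeroPart` multiplicative. -/
theorem degreeZero_add {s t : Var → ℚ≥0} : DegreeZero (s + t) ↔ DegreeZero s ∧ DegreeZero t := by
  simp only [DegreeZero, Pi.add_apply, add_eq_zero]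
  tauto

open Classical in
/-- The endomorphism of `R₀` that sends the positive powers of `X, Y, Z` to zero. -/
noncomputable def degreeZeroPart : R₀ →ₐ[ZMod 2] R₀ :=
  AddMonoidAlgebra.lift (ZMod 2) R₀ (Var → ℚ≥0)
    { toFun s := if DegreeZero s.toAdd then single s.toAdd 1 else 0
      map_one' := by simp [DegreeZero, one_def]
      map_mul' s t := by
        by_cases hs : DegreeZero s.toAdd <;> by_cases ht : DegreeZero t.toAdd <;>
          simp [degreeZero_add, hs, ht, single_mul_single] }

theorem degreeZeroPart_single_of {s : Var → ℚ≥0} (hs : DegreeZero s) (r : ZMod 2) :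
    degreeZeroPart (single s r) = single s r := by
  simp [degreeZeroPart, hs]

theorem degreeZeroPart_single_of_not {s : Var → ℚ≥0} (hs : ¬ DegreeZero s) (r : ZMod 2) :
    degreeZeroPart (single s r) = 0 := by
  simp [degreeZeroPart, hs]

theorem coeff_degreeZeroPart {s : Var → ℚ≥0} (hs : DegreeZero s) (f : R₀) :
    (degreeZeroPart f).coeff s = f.coeff s := by
  induction f using AddMonoidAlgebra.induction_linear with
  | zero => simp
  | add f g hf hg => simp [hf, hg]
  | single t r =>
    by_cases ht : DegreeZero t
    · rw [degreeZeroPart_single_of ht]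
    · rw [degreeZeroPart_single_of_not ht, coeff_single, Finsupp.single_eq_of_ne]
      · simp
      · rintro rfl; exact ht hs

/-- All powers of the `T i` can be attached to one of `X, Y, Z` that has positive exponent. -/
theorem single_mem_R {s : Var → ℚ≥0} (hs : DegreeZero s → s = 0) (r : ZMod 2) :
    single s r ∈ R := by
  have key : ∀ a b c t, expo a b c t = s → mono a b c t ∈ R → single s r ∈ R := by
    rintro a b c t rfl h
    have : (single (expo a b c t) r : R₀) = r • mono a b c t := by simp [mono]
    rw [this]
    exact R.smul_mem h r
  have hs' : expo (s Var.X) (s Var.Y) (s Var.Z) (fun i => s (Var.T i)) = s := by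
    funext v; cases v <;> rfl
  refine key _ _ _ _ hs' ?_
  have pX : ∀ a, mono a 0 0 0 ∈ R := fun a => Algebra.subset_adjoin (Or.inl ⟨a, Or.inl rfl⟩)
  have pY : ∀ a, mono 0 a 0 0 ∈ R := fun a => Algebra.subset_adjoin (Or.inl ⟨a, .inr (.inl rfl)⟩)
  have pZ : ∀ a, mono 0 0 a 0 ∈ R := fun a => Algebra.subset_adjoin (Or.inl ⟨a, .inr (.inr rfl)⟩)
  by_cases hX : s Var.X = 0
  · by_cases hY : s Var.Y = 0
    · by_cases hZ : s Var.Z = 0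
      · rw [hs ⟨hX, hY, hZ⟩]
        exact pX 0
      · have h := mul_mem (mul_mem (pX (s Var.X)) (pY (s Var.Y)))
          (Algebra.subset_adjoin (R := ZMod 2) (s := pureGenerators ∪ mixedGenerators) (Or.inr
            ⟨s Var.Z, fun i => s (Var.T i), pos_iff_ne_zero.2 hZ, .inr (.inr rfl)⟩))
        simpa [mono_mul] using h
    · have h := mul_mem (mul_mem (pX (s Var.X)) (pZ (s Var.Z)))
          (Algebra.subset_adjoin (R := ZMod 2) (s := pureGenerators ∪ mixedGenerators) (Or.inr
            ⟨s Var.Y, fun i => s (Var.T i), pos_iff_ne_zero.2 hY, .inr (.inl rfl)⟩))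
      simpa [mono_mul] using h
  · have h := mul_mem (mul_mem (pY (s Var.Y)) (pZ (s Var.Z)))
          (Algebra.subset_adjoin (R := ZMod 2) (s := pureGenerators ∪ mixedGenerators) (Or.inr
            ⟨s Var.X, fun i => s (Var.T i), pos_iff_ne_zero.2 hX, .inl rfl⟩))
    simpa [mono_mul] using h

/-- `R` consists of the elements of `R₀` whose part of degree zero in `X, Y, Z` is constant. -/
theorem mem_R_iff {f : R₀} : f ∈ R ↔ degreeZeroPart f = 0 ∨ degreeZeroPart f = 1 := by
  constructor
  · have hle : R ≤ (⊥ : Subalgebra (ZMod 2) R₀).comap degreeZeroPart := by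
      refine Algebra.adjoin_le ?_
      have key : ∀ a b c t, (DegreeZero (expo a b c t) → expo a b c t = 0) →
          mono a b c t ∈ (⊥ : Subalgebra (ZMod 2) R₀).comap degreeZeroPart := by
        intro a b c t h
        rw [Subalgebra.mem_comap]
        by_cases hd : DegreeZero (expo a b c t)
        · rw [mono, degreeZeroPart_single_of hd, h hd, ← one_def]
          exact one_mem _
        · rw [mono, degreeZeroPart_single_of_not hd]
          exact zero_mem _
      have hz : expo 0 0 0 0 = 0 := by funext v; cases v <;> rfl
      rintro _ (⟨α, rfl | rfl | rfl⟩ | ⟨α, t, hα, rfl | rfl | rfl⟩) <;> refine key _ _ _ _ ?_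
      · rintro ⟨h, -, -⟩; obtain rfl : α = 0 := h; exact hz
      · rintro ⟨-, h, -⟩; obtain rfl : α = 0 := h; exact hz
      · rintro ⟨-, -, h⟩; obtain rfl : α = 0 := h; exact hz
      · rintro ⟨h, -, -⟩; exact absurd h hα.ne'
      · rintro ⟨-, h, -⟩; exact absurd h hα.ne'
      · rintro ⟨-, -, h⟩; exact absurd h hα.ne'
    intro hf
    obtain ⟨r, hr⟩ := Algebra.mem_bot.1 (hle hf)
    have hr' : ∀ r : ZMod 2, r = 0 ∨ r = 1 := by decide
    change _ = degreeZeroPart f at hr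
    rcases hr' r with rfl | rfl
    · left; rw [← hr, map_zero]
    · right; rw [← hr, map_one]
  · intro h
    rw [← sum_coeff_single f]
    refine sum_mem fun s hs => single_mem_R (fun hd => ?_) _
    by_contra hs0
    refine Finsupp.mem_support_iff.1 hs ?_
    rw [← coeff_degreeZeroPart hd]
    rcases h with h | h <;> rw [h]
    · simp
    · rw [one_def, coeff_single, Finsupp.single_eq_of_ne hs0]

end GLExample

/-! ### The GL property -/

namespace GLExample

open Polynomial AddMonoidAlgebra

theorem eq_one_of_mul_eq_one {d e : R₀} (h : d * e = 1) : d = 1 := by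
  obtain ⟨a, b, c, c', rfl, -, hab, hc⟩ := eq_single_of_mul_eq_single one_ne_zero h
  have hc1 : ∀ c : ZMod 2, c ≠ 0 → c = 1 := by decide
  rw [(add_eq_zero.1 hab).1, hc1 c hc, one_def]

theorem degreeZeroPart_ne_zero_of_map_eq {f : Polynomial R} (hf : f.IsPrimitive) {d : R₀} {h : R₀[X]}
    (hd : f.map (algebraMap R R₀) = C d * h) : degreeZeroPart d ≠ 0 := by
  intro hd0
  obtain ⟨e, rfl⟩ := exists_sq_eq
    (fun s : Var → ℚ≥0 => ⟨fun i => s i / 2, funext fun i => add_halves (s i)⟩) d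
  rw [map_pow, sq_eq_zero_iff] at hd0
  let e' : R := ⟨e, mem_R_iff.2 (Or.inl hd0)⟩
  have hdvd : C e' ∣ f := by
    rw [C_dvd_iff_dvd_coeff]
    intro i
    have hi := congrArg (fun p => p.coeff i) hd
    simp only [Polynomial.coeff_map, coeff_C_mul] at hi
    -- The coefficient of `h` need not lie in `R`; the spare factor `e` kills its degree-zero part.
    refine ⟨⟨e * h.coeff i, mem_R_iff.2 (Or.inl (by rw [map_mul, hd0, zero_mul]))⟩, Subtype.ext ?_⟩
    exact hi.trans (by rw [sq, mul_assoc]; rfl)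
  have hu := ((hf e' hdvd).map R.val).map degreeZeroPart
  exact not_isUnit_zero (hd0 ▸ hu)

theorem eq_one_of_map_eq {f : Polynomial R} (hf : f.IsPrimitive) {d : R₀} {h : R₀[X]}
    (hd : f.map (algebraMap R R₀) = C d * h) (hd1 : degreeZeroPart d = 1) : d = 1 := by
  let d' : R := ⟨d, mem_R_iff.2 (Or.inr hd1)⟩
  have hdvd : C d' ∣ f := by
    rw [C_dvd_iff_dvd_coeff]
    intro i
    have hi := congrArg (fun p => p.coeff i) hd
    simp only [Polynomial.coeff_map, coeff_C_mul] at hi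
    -- As `d` has degree-zero part 1, the cofactor has the same degree-zero part as the coefficient
    -- of `f`.
    have hmem : h.coeff i ∈ R := by
      have h1 := mem_R_iff.1 (f.coeff i).2
      change ((f.coeff i : R) : R₀) = _ at hi
      rwa [hi, map_mul, hd1, one_mul, ← mem_R_iff] at h1
    exact ⟨⟨h.coeff i, hmem⟩, Subtype.ext hi⟩
  obtain ⟨e, he⟩ := isUnit_iff_exists_inv.1 ((hf d' hdvd).map R.val)
  exact eq_one_of_mul_eq_one he

theorem isGLDomain_R : IsGLDomain R := by
  refine ⟨inferInstance, fun f g hf hg r hr => ?_⟩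
  have := decompositionMonoid_polynomial
  have hinj : Function.Injective (algebraMap R R₀) := Subtype.val_injective
  have hdvd : C (r : R₀) ∣ f.map (algebraMap R R₀) * g.map (algebraMap R R₀) := by
    have := Polynomial.map_dvd (algebraMap R R₀) hr
    rwa [Polynomial.map_mul, map_C] at this
  have hr0 : (r : R₀) ≠ 0 := by
    rintro h0
    rw [h0, C_0, zero_dvd_iff, mul_eq_zero, Polynomial.map_eq_zero_iff hinj,
      Polynomial.map_eq_zero_iff hinj] at hdvd
    exact hdvd.elim hf.ne_zero hg.ne_zero
  obtain ⟨p, q, ⟨p', hp⟩, ⟨q', hq⟩, hpq⟩ := exists_dvd_and_dvd_of_dvd_mul hdvd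
  have hpq0 : p * q ≠ 0 := hpq ▸ C_ne_zero.2 hr0
  have hdeg := natDegree_mul (left_ne_zero_of_mul hpq0) (right_ne_zero_of_mul hpq0)
  rw [← hpq, natDegree_C] at hdeg
  obtain ⟨a, rfl⟩ := natDegree_eq_zero.1 (by omega : p.natDegree = 0)
  obtain ⟨b, rfl⟩ := natDegree_eq_zero.1 (by omega : q.natDegree = 0)
  rw [← C_mul] at hpq
  have hab : (r : R₀) = a * b := C_injective hpq
  have hab1 : degreeZeroPart a * degreeZeroPart b = 1 := by
    have h1 := mem_R_iff.1 r.2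
    rw [hab, map_mul] at h1
    exact h1.resolve_left (mul_ne_zero (degreeZeroPart_ne_zero_of_map_eq hf hp)
      (degreeZeroPart_ne_zero_of_map_eq hg hq))
  have ha := eq_one_of_map_eq hf hp (eq_one_of_mul_eq_one hab1)
  have hb := eq_one_of_map_eq hg hq (eq_one_of_mul_eq_one (mul_comm _ _ |>.trans hab1))
  have hr1 : r = 1 := Subtype.ext (by rw [hab, ha, hb, one_mul]; rfl)
  exact hr1 ▸ isUnit_one

/-! ### Infinitely many maximal common divisors -/

theorem mono_mem_R {a b c : ℚ≥0} {t : ℕ+ → ℚ≥0} (h : a = 0 → b = 0 → c = 0 → t = 0) :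
    mono a b c t ∈ R := by
  refine single_mem_R ?_ 1
  rintro ⟨h1, h2, h3⟩
  change a = 0 at h1
  change b = 0 at h2
  change c = 0 at h3
  rw [h h1 h2 h3, h1, h2, h3]
  funext v; cases v <;> rfl

/-- The element `X * ∏ i, T i ^ q` of `R`. -/
noncomputable def xT (q : ℚ≥0) : R :=
  ⟨mono 1 0 0 (fun _ => q), mono_mem_R fun h => absurd h one_ne_zero⟩

theorem isMCD_xT {q : ℚ≥0} (hq : q ≤ 1) : IsMCD ({sY, sZ} : Set R) (xT q) := by
  obtain ⟨p, hp⟩ := exists_add_of_le hq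
  have hp' : (fun _ => q) + (fun _ => p) = (1 : ℕ+ → ℚ≥0) := funext fun _ => hp.symm
  let y : R := ⟨mono 0 1 0 (fun _ => p), mono_mem_R fun _ h => absurd h one_ne_zero⟩
  let z : R := ⟨mono 0 0 1 (fun _ => p), mono_mem_R fun _ _ h => absurd h one_ne_zero⟩
  have hy : sY = xT q * y := Subtype.ext (by simp [sY, xT, y, mono_mul, hp'])
  have hz : sZ = xT q * z := Subtype.ext (by simp [sZ, xT, z, mono_mul, hp'])
  have hx : xT q ≠ 0 := fun h =>
    single_ne_zero.2 (one_ne_zero (α := ZMod 2)) (congrArg Subtype.val h)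
  refine ⟨?_, ?_⟩
  · rintro s (rfl | rfl)
    · exact ⟨y, hy⟩
    · exact ⟨z, hz⟩
  · rintro d' hd' ⟨w, rfl⟩
    obtain ⟨k, hk⟩ := hd' sY (Or.inl rfl)
    obtain ⟨l, hl⟩ := hd' sZ (Or.inr rfl)
    rw [hy, mul_assoc] at hk
    rw [hz, mul_assoc] at hl
    have hk' : (w : R₀) * (k : R₀) = single (expo 0 1 0 (fun _ => p)) 1 :=
      (congrArg Subtype.val (mul_left_cancel₀ hx hk)).symm
    have hl' : (w : R₀) * (l : R₀) = single (expo 0 0 1 (fun _ => p)) 1 :=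
      (congrArg Subtype.val (mul_left_cancel₀ hx hl)).symm
    obtain ⟨a, b, c, -, hwa, -, hab, hc⟩ := eq_single_of_mul_eq_single one_ne_zero hk'
    obtain ⟨a', b', c', -, hwa', -, hab', -⟩ := eq_single_of_mul_eq_single one_ne_zero hl'
    have haa : a = a' := ((single_inj.1 (hwa.symm.trans hwa')).resolve_right fun h => hc h.1).1
    subst haa
    -- The first cofactor is free of `X` and `Z`, the second of `Y`.
    have hd : DegreeZero a := ⟨(add_eq_zero.1 (congrFun hab Var.X)).1,
      (add_eq_zero.1 (congrFun hab' Var.Y)).1, (add_eq_zero.1 (congrFun hab Var.Z)).1⟩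
    have hw : (w : R₀) = 1 := by
      have h1 := mem_R_iff.1 w.2
      rw [hwa, degreeZeroPart_single_of hd] at h1
      rw [hwa]
      exact h1.resolve_left (single_ne_zero.2 hc)
    rw [show w = 1 from Subtype.ext hw, mul_one]
    exact Associated.refl _

theorem le_of_xT_dvd {q q' : ℚ≥0} (h : xT q ∣ xT q') : q ≤ q' := by
  obtain ⟨w, hw⟩ := h
  have hw' : (xT q : R₀) * (w : R₀) = single (expo 1 0 0 (fun _ => q')) 1 :=
    (congrArg Subtype.val hw).symm
  obtain ⟨a, b, c, -, ha, -, hab, hc⟩ := eq_single_of_mul_eq_single one_ne_zero hw'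
  obtain rfl : expo 1 0 0 (fun _ => q) = a :=
    ((single_inj.1 ha).resolve_right fun h => hc h.2).1
  exact (le_self_add (a := q)).trans (congrFun hab (Var.T 1)).le

theorem infinite_mcdClasses : (mcdClasses ({sY, sZ} : Set R)).Infinite := by
  have hI : (Set.Iic (1 : ℚ≥0)).Infinite := by
    refine Set.infinite_of_injective_forall_mem (f := fun n : ℕ => ((n : ℚ≥0) + 1)⁻¹) ?_ ?_
    · intro m n h
      simpa using h
    · intro n
      exact inv_le_one_of_one_le₀ (le_add_of_nonneg_left (zero_le (a := (n : ℚ≥0))))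
  refine (hI.image (f := fun q => Associates.mk (xT q)) ?_).mono ?_
  · intro q _ q' _ h
    have h' := Associates.mk_eq_mk_iff_associated.1 h
    exact le_antisymm (le_of_xT_dvd h'.dvd) (le_of_xT_dvd h'.symm.dvd)
  · rintro _ ⟨q, hq, rfl⟩
    exact ⟨xT q, isMCD_xT hq, rfl⟩

theorem not_isMCDFinite_R : ¬ IsMCDFinite R := by
  intro h
  refine infinite_mcdClasses (h {sY, sZ} (Set.toFinite _) (Set.insert_nonempty _ _) ?_)
  rintro (h0 | h0) <;>
    exact single_ne_zero.2 (one_ne_zero (α := ZMod 2)) (congrArg Subtype.val h0).symm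

end GLExample

theorem mainTheorem4 :
    GLExample.IsGLDomain GLExample.R ∧
      ¬ GLExample.IsMCDFinite GLExample.R ∧
      (GLExample.mcdClasses ({GLExample.sY, GLExample.sZ} : Set GLExample.R)).Infinite :=
  ⟨GLExample.isGLDomain_R, GLExample.not_isMCDFinite_R, GLExample.infinite_mcdClasses⟩
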